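/- Let $\mathcal H$ be a real Hilbert space, let $A\colon\mathcal H\to 2^{\mathcal H}$ be maximally monotone, and let $B\colon\mathcal H\to\mathcal H$ be monotone and $\mu$-Lipschitzian, that is, $\|Bx-By\|\le\mu\|x-y\|$ for all $x,y\in\mathcal H$, where $\mu\in\left]0,+\infty\right[$. Suppose that the set $\operatorname{zer}(A+B)=\{x\in\mathcal H : 0\in Ax+Bx\}$ is nonempty. Let $\gamma\in\left]0,+\infty\right[$, let $x_{-1},x_0\in\mathcal H$, and let $(x_n)_{n\in\mathbb N}$ be generated by the reflected forward-backward iteration $$(\forall n\in\mathbb N)\quad y_n=2x_n-x_{n-1},\qquad x_{n+1}=J_{\gamma A}(x_n-\gamma By_n),\qquad\text{where } J_{\gamma A}=(\operatorname{Id}+\gamma A)^{-1}.$$ Then the following hold. (i) Suppose that $B$ is $\beta$-cocoercive for some $\beta\in\left]0,+\infty\right[$, that is, $\langle x-y, Bx-By\rangle\ge\beta\|Bx-By\|^2$ for all $x,y\in\mathcal H$, and that $\gamma\in\left]0,\beta(1-\varepsilon)/2\right]$ for some $\varepsilon\in\left]0,1\right[$. Then $(x_n)_{n\in\mathbb N}$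 converges weakly to some point $\overline x\in\operatorname{zer}(A+B)$. (ii) Suppose that $\gamma\in\left]0,(\sqrt2-1)/\mu\right[$. Then $(x_n)_{n\in\mathbb N}$ converges weakly to some point $\overline x\in\operatorname{zer}(A+B)$. -/

import Mathlib

open Set Filter Topology
open scoped Pointwise NNReal

namespace MonotoneInclusion

variable {H : Type*} [NormedAddCommGroup H] [InnerProductSpace ℝ H]

/-- The graph of a set-valued operator `T : H → 2^H`. -/
def gra (T : H → Set H) : Set (H × H) := {p | p.2 ∈ T p.1}

/-- The inverse of a set-valued operator, `T⁻¹ u = {x | u ∈ T x}`. -/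
def opInv (T : H → Set H) : H → Set H := fun u => {x | u ∈ T x}

/-- The set of zeros `zer T = T⁻¹ 0`. -/
def zer (T : H → Set H) : Set H := opInv T 0

/-- A single-valued operator, seen as a set-valued one. -/
def toSetOp (B : H → H) : H → Set H := fun x => {B x}

/-- Monotonicity of a set-valued operator. -/
def IsMonotoneOp (T : H → Set H) : Prop :=
  ∀ x y u v : H, u ∈ T x → v ∈ T y → 0 ≤ inner ℝ (x - y) (u - v)

/-- Maximal monotonicity: no monotone operator has a graph properly containing that of `T`. -/
def IsMaximallyMonotone (T : H → Set H) : Prop :=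
  IsMonotoneOp T ∧ ¬ ∃ S : H → Set H, IsMonotoneOp S ∧ gra T ⊂ gra S

/-- The resolvent `J_T = (Id + T)⁻¹`, as a set-valued operator; the sum is the pointwise
Minkowski sum of set-valued operators. -/
def resolventOp (T : H → Set H) : H → Set H := opInv (toSetOp id + T)

/-- `B` is `β`-cocoercive. -/
def IsCocoercive (β : ℝ) (B : H → H) : Prop :=
  ∀ x y : H, β * ‖B x - B y‖ ^ 2 ≤ inner ℝ (x - y) (B x - B y)

/-- `(x n)` and `(y n)` are generated by the reflected forward-backward iteration with step `γ`
from the starting points `x 0` and `xneg` (the latter is the iterate of index `-1`). -/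
structure IsReflectedForwardBackward (A : H → Set H) (B : H → H) (γ : ℝ) (xneg : H)
    (x y : ℕ → H) : Prop where
  y_zero : y 0 = (2 : ℝ) • x 0 - xneg
  y_succ : ∀ n, y (n + 1) = (2 : ℝ) • x (n + 1) - x n
  x_succ : ∀ n, x (n + 1) ∈ resolventOp (γ • A) (x n - γ • B (y n))

/-- Weak convergence of a sequence, i.e. convergence in the weak topology of `H`. -/
def WeaklyConvergesTo (x : ℕ → H) (l : H) : Prop :=
  Tendsto (fun n => toWeakSpace ℝ H (x n)) atTop (𝓝 (toWeakSpace ℝ H l))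

end MonotoneInclusion

namespace MonotoneInclusion

variable {H : Type*} [NormedAddCommGroup H] [InnerProductSpace ℝ H]

/-! For a zero z, monotonicity of γA between the new iterate and z, and between successive iterates,
yields `energy_step`: ‖wₙ - z‖² plus corrections decreases, up to a cross term pairing the change in
B with a second difference of iterates. Young's inequality absorbs that term, using cocoercivity
with 2γ < β in (i) and the Lipschitz bound with γμ < √2 - 1 in (ii). Hence successive differences
vanish and ‖wₙ - z‖² converges. Weak cluster points are zeros by `mem_zer_of_weak_limit`, and
`opial` concludes. -/

theorem energy_step (γ : ℝ) {z w₁ w₂ w₃ b b' c : H}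
    (h₁ : 0 ≤ inner ℝ (w₃ - z) ((w₂ - γ • b' - w₃) - -(γ • c)))
    (h₂ : 0 ≤ inner ℝ (w₃ - w₂) ((w₂ - γ • b' - w₃) - (w₁ - γ • b - w₂))) :
    ‖w₃ - z‖ ^ 2 + 2 * γ * inner ℝ (b' - c) (w₃ - w₂) + 2 * ‖w₃ - w₂‖ ^ 2 +
        ‖w₃ - w₂ - (w₂ - w₁)‖ ^ 2 +
        2 * γ * inner ℝ ((2 : ℝ) • w₂ - w₁ - z) (b' - c) ≤
      ‖w₂ - z‖ ^ 2 + 2 * γ * inner ℝ (b - c) (w₂ - w₁) + ‖w₂ - w₁‖ ^ 2 -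
        2 * γ * inner ℝ (b' - b) (w₃ - w₂ - (w₂ - w₁)) := by
  simp only [← real_inner_self_eq_norm_sq, inner_sub_left, inner_sub_right, inner_smul_left,
    inner_smul_right, inner_neg_right, RCLike.conj_to_real] at *
  simp only [real_inner_comm w₂ w₃, real_inner_comm w₁ w₃, real_inner_comm w₁ w₂,
    real_inner_comm z w₃, real_inner_comm z w₂, real_inner_comm w₃ b,
    real_inner_comm w₂ b, real_inner_comm w₁ b, real_inner_comm w₃ b',
    real_inner_comm w₂ b', real_inner_comm w₁ b', real_inner_comm w₃ c,
    real_inner_comm w₂ c, real_inner_comm w₁ c] at *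
  -- The inequality is 2·h₁ + 2·h₂, rewritten with w₃ - z = (2w₂ - w₁ - z) + (w₃ - w₂ - (w₂ - w₁)).
  linarith

/-! ### Weak limits, maximality and Opial's lemma -/

/-- Weak convergence along a filter, tested against inner products. -/
theorem weaklyConvergesTo_of_inner [CompleteSpace H] {x : ℕ → H} {l : H}
    (h : ∀ w, Tendsto (fun n => inner ℝ w (x n)) atTop (𝓝 (inner ℝ w l))) :
    WeaklyConvergesTo x l := by
  have hinj : Function.Injective (topDualPairing ℝ H).flip := fun a b hab =>
    ext_inner_left ℝ fun v => LinearMap.congr_fun hab (InnerProductSpace.toDual ℝ H v)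
  refine (WeakBilin.tendsto_iff_forall_eval_tendsto _ hinj).2 fun f => ?_
  have := h ((InnerProductSpace.toDual ℝ H).symm f)
  simp only [InnerProductSpace.toDual_symm_apply] at this
  exact this

/-- Banach–Alaoglu through the Riesz isometry; ultrafilters stand in for subsequences. -/
theorem exists_ultrafilter_weak_limit [CompleteSpace H] {ι : Type*} (U : Ultrafilter ι) {x : ι → H}
    {C : ℝ} (hC : ∀ i, ‖x i‖ ≤ C) :
    ∃ l, ∀ w, Tendsto (fun i => inner ℝ w (x i)) U (𝓝 (inner ℝ w l)) := by
  obtain ⟨f, -, hf⟩ := (WeakDual.isCompact_closedBall (𝕜 := ℝ) (E := H) 0 C).ultrafilter_le_nhds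
    (U.map fun i => StrongDual.toWeakDual (InnerProductSpace.toDual ℝ H (x i))) <| by
      refine le_principal_iff.2 (Ultrafilter.mem_map.2 (Filter.univ_mem' fun i => ?_))
      simpa using hC i
  refine ⟨(InnerProductSpace.toDual ℝ H).symm (WeakDual.toStrongDual f), fun w => ?_⟩
  have h := ((WeakDual.eval_continuous (𝕜 := ℝ) w).tendsto f).comp
    (show Tendsto (fun i => StrongDual.toWeakDual (InnerProductSpace.toDual ℝ H (x i))) U (𝓝 f)
      from hf)
  rw [real_inner_comm, InnerProductSpace.toDual_symm_apply]
  refine h.congr fun i => ?_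
  exact real_inner_comm _ _

/-- Adjoining (x, u) to the graph keeps it monotone, so it was already there. -/
theorem IsMaximallyMonotone.mem {A : H → Set H} (hA : IsMaximallyMonotone A) {x u : H}
    (h : ∀ y v, v ∈ A y → 0 ≤ inner ℝ (x - y) (u - v)) : u ∈ A x := by
  by_contra hu
  refine hA.2 ⟨fun y => A y ∪ {v | y = x ∧ v = u}, ?_, ?_⟩
  · rintro a b p q (hp | ⟨rfl, rfl⟩) (hq | ⟨rfl, rfl⟩)
    · exact hA.1 _ _ _ _ hp hq
    · rw [← inner_neg_neg, neg_sub, neg_sub]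
      exact h _ _ hp
    · exact h _ _ hq
    · simp
  · refine ⟨fun p hp => Or.inl hp, fun hsub => hu ?_⟩
    exact hsub (show (x, u) ∈ _ from Or.inr ⟨rfl, rfl⟩)

/-- Minty's trick. -/
theorem eq_of_forall_inner_nonneg {B : H → H} (hB : Continuous B) {l q : H}
    (h : ∀ u, 0 ≤ inner ℝ (l - u) (q - B u)) : q = B l := by
  -- Test at l - t(Bl - q) and divide by t; then t → 0 gives -‖Bl - q‖² ≥ 0.
  have key : ∀ t : ℝ, 0 < t → 0 ≤ inner ℝ (B l - q) (q - B (l - t • (B l - q))) := by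
    intro t ht
    have := h (l - t • (B l - q))
    rw [sub_sub_cancel, inner_smul_left, RCLike.conj_to_real] at this
    exact nonneg_of_mul_nonneg_right this ht
  have hlim : Tendsto (fun t : ℝ => inner ℝ (B l - q) (q - B (l - t • (B l - q)))) (𝓝[>] 0)
      (𝓝 (inner ℝ (B l - q) (q - B l))) := by
    have : Continuous fun t : ℝ => inner ℝ (B l - q) (q - B (l - t • (B l - q))) := by fun_prop
    simpa using (this.tendsto 0).mono_left nhdsWithin_le_nhds
  have h0 := ge_of_tendsto hlim (eventually_mem_nhdsWithin.mono key)
  rw [← neg_sub (B l) q, inner_neg_right, real_inner_self_eq_norm_sq] at h0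
  have : B l - q = 0 := by
    rw [← norm_eq_zero]; nlinarith [norm_nonneg (B l - q)]
  exact (sub_eq_zero.1 this).symm

/-- Opial's lemma. -/
theorem opial [CompleteSpace H] {S : Set H} {x : ℕ → H} (hS : S.Nonempty)
    (hx : ∀ z ∈ S, ∃ r : ℝ, Tendsto (fun n => ‖x n - z‖ ^ 2) atTop (𝓝 r))
    (hcl : ∀ U : Ultrafilter ℕ, ↑U ≤ (atTop : Filter ℕ) → ∀ l,
      (∀ w, Tendsto (fun n => inner ℝ w (x n)) U (𝓝 (inner ℝ w l))) → l ∈ S) :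
    ∃ l ∈ S, WeaklyConvergesTo x l := by
  obtain ⟨z, hz⟩ := hS
  obtain ⟨r, hr⟩ := hx z hz
  obtain ⟨M, hM⟩ := hr.bddAbove_range
  have hbd : ∀ n, ‖x n‖ ≤ √M + ‖z‖ := fun n => by
    have h1 : ‖x n - z‖ ≤ √M := Real.le_sqrt_of_sq_le (hM ⟨n, rfl⟩)
    have h2 := norm_add_le (x n - z) z
    rw [sub_add_cancel] at h2
    linarith
  have hU (U : Ultrafilter ℕ) := exists_ultrafilter_weak_limit U hbd
  have huniq : ∀ U V : Ultrafilter ℕ, ↑U ≤ (atTop : Filter ℕ) → ↑V ≤ (atTop : Filter ℕ) →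
      ∀ l m, (∀ w, Tendsto (fun n => inner ℝ w (x n)) U (𝓝 (inner ℝ w l))) →
      (∀ w, Tendsto (fun n => inner ℝ w (x n)) V (𝓝 (inner ℝ w m))) → l = m := by
    intro U V hU hV l m hl hm
    obtain ⟨r, hr⟩ := hx l (hcl U hU l hl)
    obtain ⟨s, hs⟩ := hx m (hcl V hV m hm)
    -- ‖x n - l‖² - ‖x n - m‖² is affine in x n, so this inner product converges along the whole
    -- sequence.
    have hd : Tendsto (fun n => inner ℝ (m - l) (x n)) atTop
        (𝓝 ((r - s - ‖l‖ ^ 2 + ‖m‖ ^ 2) / 2)) := by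
      convert (((hr.sub hs).sub_const (‖l‖ ^ 2)).add_const (‖m‖ ^ 2)).div_const 2 using 2 with n
      rw [norm_sub_sq_real, norm_sub_sq_real, inner_sub_left, real_inner_comm m,
        real_inner_comm l]
      ring
    have e : (inner ℝ (m - l) l : ℝ) = inner ℝ (m - l) m :=
      (tendsto_nhds_unique (hl _) (hd.mono_left hU)).trans
        (tendsto_nhds_unique (hm _) (hd.mono_left hV)).symm
    have : (inner ℝ (m - l) (m - l) : ℝ) = 0 := by rw [inner_sub_right, e, sub_self]
    exact (sub_eq_zero.1 (inner_self_eq_zero.1 this)).symm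
  obtain ⟨l, hl⟩ := hU (Ultrafilter.of atTop)
  refine ⟨l, hcl _ (Ultrafilter.of_le _) l hl, weaklyConvergesTo_of_inner fun w => ?_⟩
  refine (tendsto_iff_ultrafilter _ _ _).2 fun V hV => ?_
  obtain ⟨m, hm⟩ := hU V
  rw [huniq _ V (Ultrafilter.of_le _) hV l m hl hm]
  exact hm w

theorem exists_tendsto_of_add_le {V D : ℕ → ℝ} (hV : ∀ n, 0 ≤ V n) (hD : ∀ n, 0 ≤ D n)
    (h : ∀ n, V (n + 1) + D n ≤ V n) :
    (∃ r, Tendsto V atTop (𝓝 r)) ∧ Tendsto D atTop (𝓝 0) := by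
  have hanti : Antitone V := antitone_nat_of_succ_le fun n => by linarith [h n, hD n]
  have ht := tendsto_atTop_ciInf hanti ⟨0, by rintro _ ⟨n, rfl⟩; exact hV n⟩
  refine ⟨⟨_, ht⟩, squeeze_zero hD (fun n => by linarith [h n] : ∀ n, D n ≤ V n - V (n + 1)) ?_⟩
  simpa using ht.sub (ht.comp (tendsto_add_atTop_nat 1))

theorem mem_zer_add_toSetOp {E : Type*} [NormedAddCommGroup E] {A : E → Set E} {B : E → E} {z : E} :
    z ∈ zer (A + toSetOp B) ↔ -B z ∈ A z := by
  simp only [zer, opInv, toSetOp, mem_ofPred_eq, Pi.add_apply, Set.mem_add, mem_singleton_iff]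
  constructor
  · rintro ⟨a, ha, b, rfl, h⟩
    rwa [← eq_neg_of_add_eq_zero_left h]
  · exact fun h => ⟨_, h, _, rfl, neg_add_cancel _⟩

theorem mem_resolventOp_smul {A : H → Set H} {γ : ℝ} (hγ : γ ≠ 0) {p x : H}
    (h : p ∈ resolventOp (γ • A) x) : γ⁻¹ • (x - p) ∈ A p := by
  simp only [resolventOp, opInv, toSetOp, mem_ofPred_eq, Pi.add_apply, Set.mem_add,
    mem_singleton_iff, Pi.smul_apply, Set.mem_smul_set] at h
  obtain ⟨_, rfl, _, ⟨a, ha, rfl⟩, rfl⟩ := h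
  simpa [hγ] using ha

theorem tendsto_inner_of_bdd_of_zero {ι : Type*} {F : Filter ι} {f g : ι → H} {C : ℝ}
    (hf : ∀ i, ‖f i‖ ≤ C) (hg : Tendsto g F (𝓝 0)) :
    Tendsto (fun i => inner ℝ (f i) (g i)) F (𝓝 (0 : ℝ)) := by
  refine squeeze_zero_norm (a := fun i => C * ‖g i‖) (fun i => ?_) ?_
  · exact (norm_inner_le_norm _ _).trans (mul_le_mul_of_nonneg_right (hf i) (norm_nonneg _))
  · simpa using hg.norm.const_mul C

/-! ### Demiclosedness -/

/-- The sum of a maximally monotone operator and a continuous monotone one has a demiclosed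
graph at the value `0`. -/
theorem mem_zer_of_weak_limit [CompleteSpace H] {A : H → Set H} {B : H → H}
    (hA : IsMaximallyMonotone A) (hB : IsMonotoneOp (toSetOp B)) (hBc : Continuous B)
    {ι : Type*} (U : Ultrafilter ι) {a u y : ι → H} {l : H} {C C' : ℝ}
    (hu : ∀ i, u i ∈ A (a i)) (hy : ∀ i, ‖y i‖ ≤ C) (hBy : ∀ i, ‖B (y i)‖ ≤ C')
    (hay : Tendsto (fun i => a i - y i) U (𝓝 0)) (huB : Tendsto (fun i => u i + B (y i)) U (𝓝 0))
    (hl : ∀ w, Tendsto (fun i => inner ℝ w (y i)) U (𝓝 (inner ℝ w l))) :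
    l ∈ zer (A + toSetOp B) := by
  obtain ⟨q, hq⟩ := exists_ultrafilter_weak_limit U hBy
  -- Weak limits alone do not give σ = ⟨l, q⟩. Monotonicity of B at l gives ⟨l, q⟩ ≤ σ; this puts -q
  -- in A l by maximality, and A tested at (l, -q) gives the converse.
  obtain ⟨σ, -, hσ⟩ := (isCompact_Icc (a := -(C * C')) (b := C * C')).ultrafilter_le_nhds
    (U.map fun i => (inner ℝ (y i) (B (y i)) : ℝ)) <| by
      refine le_principal_iff.2 (Ultrafilter.mem_map.2 (Filter.univ_mem' fun i => ?_))
      refine abs_le.1 ((abs_real_inner_le_norm _ _).trans ?_)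
      exact mul_le_mul (hy i) (hBy i) (norm_nonneg _) ((norm_nonneg _).trans (hy i))
  replace hσ : Tendsto (fun i => (inner ℝ (y i) (B (y i)) : ℝ)) U (𝓝 σ) := hσ
  have limA : ∀ p v, v ∈ A p → 0 ≤ -σ - inner ℝ v l + inner ℝ p q + inner ℝ p v := by
    intro p v hv
    have e₁ : Tendsto (fun i => inner ℝ (B (y i) + v) (a i - y i)) U (𝓝 (0 : ℝ)) :=
      tendsto_inner_of_bdd_of_zero (C := C' + ‖v‖)
        (fun i => (norm_add_le _ _).trans (by linarith [hBy i])) hay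
    have e₂ : Tendsto (fun i => inner ℝ (y i - p) (u i + B (y i))) U (𝓝 (0 : ℝ)) :=
      tendsto_inner_of_bdd_of_zero (C := C + ‖p‖)
        (fun i => (norm_sub_le _ _).trans (by linarith [hy i])) huB
    have e₃ : Tendsto (fun i => inner ℝ (a i - y i) (u i + B (y i))) U (𝓝 (0 : ℝ)) := by
      simpa using hay.inner (𝕜 := ℝ) huB
    have e := ((((hσ.neg.sub (hl v)).add (hq p)).add_const (inner ℝ p v)).sub e₁).add e₂ |>.add e₃
    simp only [sub_zero, add_zero] at e
    refine ge_of_tendsto' e fun i => ?_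
    refine (hA.1 _ _ _ _ (hu i) hv).trans_eq ?_
    simp only [inner_sub_left, inner_sub_right, inner_add_left, inner_add_right]
    simp only [real_inner_comm (B (y i)), real_inner_comm v]
    ring
  have limB : ∀ p, 0 ≤ σ - inner ℝ (B p) l - inner ℝ p q + inner ℝ p (B p) := by
    intro p
    have e := ((hσ.sub (hl (B p))).sub (hq p)).add_const (inner ℝ p (B p))
    refine ge_of_tendsto' e fun i => ?_
    refine (hB _ _ _ _ (mem_singleton (B (y i))) (mem_singleton (B p))).trans_eq ?_
    simp only [inner_sub_left, inner_sub_right, real_inner_comm (B p) (y i)]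
    ring
  have hσl : inner ℝ l q ≤ σ := by
    have := limB l
    rw [real_inner_comm] at this
    linarith
  have hqA : -q ∈ A l := by
    refine hA.mem fun p v hv => ?_
    have := limA p v hv
    simp only [inner_sub_left, inner_sub_right, inner_neg_right]
    rw [real_inner_comm] at this
    linarith
  have hσl' : σ ≤ inner ℝ l q := by
    have := limA l _ hqA
    simp only [inner_neg_left, inner_neg_right, real_inner_comm l q] at this
    linarith
  have hqB : q = B l := by
    refine eq_of_forall_inner_nonneg hBc fun p => ?_
    have := limB p
    simp only [inner_sub_left, inner_sub_right]
    rw [real_inner_comm] at this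
    linarith
  exact mem_zer_add_toSetOp.2 (hqB ▸ hqA)

/-! ### Orbits of the iteration -/

/-- The reflected forward-backward recursion, indexed from the first starting point. -/
def IsReflectedOrbit (A : H → Set H) (B : H → H) (γ : ℝ) (w : ℕ → H) : Prop :=
  ∀ n, γ⁻¹ • (w (n + 1) - γ • B ((2 : ℝ) • w (n + 1) - w n) - w (n + 2)) ∈ A (w (n + 2))

/-- Shifting the index by one makes w 0 and w 1 the two starting points. -/
theorem IsReflectedForwardBackward.isReflectedOrbit {A : H → Set H} {B : H → H} {γ : ℝ}
    (hγ : γ ≠ 0) {xneg : H} {x y : ℕ → H} (hx : IsReflectedForwardBackward A B γ xneg x y) :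
    IsReflectedOrbit A B γ (fun n => Nat.casesOn n xneg x) := by
  intro n
  have h := mem_resolventOp_smul hγ (hx.x_succ n)
  cases n with
  | zero => rwa [hx.y_zero] at h
  | succ n => rwa [hx.y_succ] at h

/-- Vanishing differences give the reflected points and the iterates the same weak limits, and make
the residuals γ⁻¹(w (n + 1) - w (n + 2)) vanish. -/
theorem IsReflectedOrbit.exists_weak_limit [CompleteSpace H] {A : H → Set H} {B : H → H} {γ : ℝ}
    {w : ℕ → H} (hw : IsReflectedOrbit A B γ w) (hγ : γ ≠ 0) {μ : ℝ≥0}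
    (hA : IsMaximallyMonotone A) (hB : IsMonotoneOp (toSetOp B)) (hBL : LipschitzWith μ B)
    (hzer : (zer (A + toSetOp B)).Nonempty)
    (hd : Tendsto (fun n => w (n + 1) - w n) atTop (𝓝 0))
    (hF : ∀ z ∈ zer (A + toSetOp B), ∃ r : ℝ, Tendsto (fun n => ‖w n - z‖ ^ 2) atTop (𝓝 r)) :
    ∃ l ∈ zer (A + toSetOp B), WeaklyConvergesTo w l := by
  refine opial hzer hF fun U hU l hl => ?_
  obtain ⟨z, hz⟩ := hzer
  obtain ⟨r, hr⟩ := hF z hz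
  obtain ⟨M, hM⟩ := hr.bddAbove_range
  have hbd : ∀ n, ‖w n - z‖ ≤ √M := fun n => Real.le_sqrt_of_sq_le (hM ⟨n, rfl⟩)
  have hyz : ∀ n, ‖(2 : ℝ) • w (n + 1) - w n - z‖ ≤ 3 * √M := fun n => by
    rw [show (2 : ℝ) • w (n + 1) - w n - z = (2 : ℝ) • (w (n + 1) - z) - (w n - z) by module]
    refine (norm_sub_le _ _).trans ?_
    rw [norm_smul, Real.norm_ofNat]
    linarith [hbd n, hbd (n + 1)]
  have hd' : Tendsto (fun n => w (n + 2) - w (n + 1)) atTop (𝓝 0) :=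
    hd.comp (tendsto_add_atTop_nat 1)
  refine mem_zer_of_weak_limit hA hB hBL.continuous U (C := 3 * √M + ‖z‖)
    (C' := μ * (3 * √M) + ‖B z‖) (y := fun n => (2 : ℝ) • w (n + 1) - w n) hw
    (fun n => ?_) (fun n => ?_) ?_ ?_ (fun v => ?_)
  · linarith [norm_le_insert' ((2 : ℝ) • w (n + 1) - w n) z, hyz n]
  · have h := (hBL.norm_sub_le ((2 : ℝ) • w (n + 1) - w n) z).trans
      (mul_le_mul_of_nonneg_left (hyz n) μ.2)
    linarith [norm_le_insert' (B ((2 : ℝ) • w (n + 1) - w n)) (B z)]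
  · have := (hd'.sub hd).mono_left hU
    rw [sub_zero] at this
    refine this.congr fun n => ?_
    module
  · have := (hd'.const_smul (-γ⁻¹)).mono_left hU
    rw [smul_zero] at this
    refine this.congr fun n => ?_
    rw [sub_right_comm, smul_sub γ⁻¹ _ (γ • _), inv_smul_smul₀ hγ]
    module
  · have h := ((hd.mono_left hU).const_smul (2 : ℝ))
    have h' := (hl v).add ((tendsto_const_nhds (x := v)).inner (𝕜 := ℝ) h)
    rw [smul_zero, inner_zero_right, add_zero] at h'
    refine h'.congr fun n => ?_
    rw [← inner_add_right]
    congr 1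
    module

theorem IsReflectedOrbit.energy_step {A : H → Set H} {B : H → H} {γ : ℝ} (hγ : 0 < γ) {w : ℕ → H}
    (hw : IsReflectedOrbit A B γ w) (hA : IsMonotoneOp A) {z : H} (hz : z ∈ zer (A + toSetOp B))
    (n : ℕ) {b b' : H} (hb : b = B ((2 : ℝ) • w (n + 1) - w n))
    (hb' : b' = B ((2 : ℝ) • w (n + 2) - w (n + 1))) :
    ‖w (n + 3) - z‖ ^ 2 + 2 * γ * inner ℝ (b' - B z) (w (n + 3) - w (n + 2)) +
        2 * ‖w (n + 3) - w (n + 2)‖ ^ 2 + ‖w (n + 3) - w (n + 2) - (w (n + 2) - w (n + 1))‖ ^ 2 +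
        2 * γ * inner ℝ ((2 : ℝ) • w (n + 2) - w (n + 1) - z) (b' - B z) ≤
      ‖w (n + 2) - z‖ ^ 2 + 2 * γ * inner ℝ (b - B z) (w (n + 2) - w (n + 1)) +
        ‖w (n + 2) - w (n + 1)‖ ^ 2 -
        2 * γ * inner ℝ (b' - b) (w (n + 3) - w (n + 2) - (w (n + 2) - w (n + 1))) := by
  have scale : ∀ x y u v : H, γ⁻¹ • u ∈ A x → γ⁻¹ • v ∈ A y → 0 ≤ inner ℝ (x - y) (u - v) := by
    intro x y u v hu hv
    have h := hA _ _ _ _ hu hv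
    rw [← smul_sub, inner_smul_right] at h
    exact nonneg_of_mul_nonneg_right h (inv_pos.2 hγ)
  subst hb hb'
  refine MonotoneInclusion.energy_step γ (scale _ _ _ _ (hw (n + 1)) ?_)
    (scale _ _ _ _ (hw (n + 1)) (hw n))
  rw [smul_neg, inv_smul_smul₀ hγ.ne']
  exact mem_zer_add_toSetOp.1 hz

theorem tendsto_zero_of_sq {ι E : Type*} [NormedAddCommGroup E] {F : Filter ι} {f : ι → E}
    (h : Tendsto (fun i => ‖f i‖ ^ 2) F (𝓝 0)) : Tendsto f F (𝓝 0) := by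
  rw [tendsto_zero_iff_norm_tendsto_zero]
  have := h.sqrt
  simpa [Real.sqrt_sq (norm_nonneg _)] using this

/-! ### Cocoercive case -/

theorem IsReflectedOrbit.fejer_of_cocoercive {A : H → Set H} {B : H → H}
    {γ β : ℝ} (hγ : 0 < γ) (hγβ : 2 * γ < β) {w : ℕ → H} (hw : IsReflectedOrbit A B γ w)
    (hA : IsMonotoneOp A) (hB : IsCocoercive β B) {z : H} (hz : z ∈ zer (A + toSetOp B)) :
    Tendsto (fun n => w (n + 1) - w n) atTop (𝓝 0) ∧
      ∃ r : ℝ, Tendsto (fun n => ‖w n - z‖ ^ 2) atTop (𝓝 r) := by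
  set b : ℕ → H := fun n => B ((2 : ℝ) • w (n + 1) - w n) - B z with hb
  set d : ℕ → H := fun n => w (n + 2) - w (n + 1) with hd
  -- Cocoercivity earns 2γβ‖b (n + 1)‖²; the cross term, via the parallelogram law, and the last
  -- term of R each cost 2γ²‖b (n + 1)‖².
  set κ : ℝ := 2 * γ * β - 4 * γ ^ 2 with hκ
  have hκ0 : 0 < κ := by rw [hκ]; nlinarith
  set R : ℕ → ℝ := fun n => 2 * γ * inner ℝ (b n) (d n) + ‖d n‖ ^ 2 + 2 * γ ^ 2 * ‖b n‖ ^ 2 with hR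
  obtain ⟨⟨r, hr⟩, hD⟩ := exists_tendsto_of_add_le (V := fun n => ‖w (n + 2) - z‖ ^ 2 + R n)
    (D := fun n => ‖d (n + 1)‖ ^ 2 + κ * ‖b (n + 1)‖ ^ 2) (fun n => by
      have h₁ := (abs_le.1 (abs_real_inner_le_norm (b n) (d n))).1
      have h₂ := mul_le_mul_of_nonneg_left h₁ hγ.le
      simp only [hR]
      nlinarith [sq_nonneg (γ * ‖b n‖ - ‖d n‖), sq_nonneg (γ * ‖b n‖), sq_nonneg ‖w (n + 2) - z‖])
    (fun n => by positivity) (fun n => by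
      have h := hw.energy_step hγ hA hz n rfl rfl
      have hc := mul_le_mul_of_nonneg_left
        (hB ((2 : ℝ) • w (n + 2) - w (n + 1)) z) (mul_pos two_pos hγ).le
      have hbb : B ((2 : ℝ) • w (n + 2) - w (n + 1)) - B ((2 : ℝ) • w (n + 1) - w n) =
        b (n + 1) - b n := by simp only [hb]; abel
      rw [hbb] at h
      change _ + 2 * γ * inner ℝ (b (n + 1)) (d (n + 1)) + 2 * ‖d (n + 1)‖ ^ 2 +
        ‖d (n + 1) - d n‖ ^ 2 + 2 * γ * _ ≤ _ + 2 * γ * inner ℝ (b n) (d n) + ‖d n‖ ^ 2 -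
          2 * γ * inner ℝ _ (d (n + 1) - d n) at h
      change 2 * γ * (β * ‖b (n + 1)‖ ^ 2) ≤ _ at hc
      have h₁ := (abs_le.1 (abs_real_inner_le_norm (b (n + 1) - b n) (d (n + 1) - d n))).1
      have h₂ := mul_le_mul_of_nonneg_left h₁ hγ.le
      have h₃ := parallelogram_law_with_norm ℝ (b (n + 1)) (b n)
      have h₄ := mul_le_mul_of_nonneg_left (sq_nonneg ‖b (n + 1) + b n‖) (sq_nonneg γ)
      have h₅ := congrArg (γ ^ 2 * ·) h₃
      simp only [hR, hκ]
      linarith [sq_nonneg (γ * ‖b (n + 1) - b n‖ - ‖d (n + 1) - d n‖)])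
  have hd0 : Tendsto d atTop (𝓝 0) := by
    rw [← tendsto_add_atTop_iff_nat 1]
    exact tendsto_zero_of_sq (squeeze_zero (fun n => by positivity)
      (fun n => le_add_of_nonneg_right (by positivity)) hD)
  have hb0 : Tendsto b atTop (𝓝 0) := by
    rw [← tendsto_add_atTop_iff_nat 1]
    refine tendsto_zero_of_sq (squeeze_zero (fun n => by positivity) (fun n => ?_)
      (by simpa using hD.const_mul κ⁻¹))
    rw [mul_add, inv_mul_cancel_left₀ hκ0.ne']
    exact le_add_of_nonneg_left (by positivity)
  refine ⟨(tendsto_add_atTop_iff_nat 1).1 hd0, r, (tendsto_add_atTop_iff_nat 2).1 ?_⟩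
  have hR0 : Tendsto R atTop (𝓝 0) := by
    simpa using (((hb0.inner (𝕜 := ℝ) hd0).const_mul (2 * γ)).add (hd0.norm.pow 2)).add
      ((hb0.norm.pow 2).const_mul (2 * γ ^ 2))
  simpa using hr.sub hR0

/-! ### Lipschitz case -/

/-- Any s between a/(1 - 2a) and 1/a works; the interval is nonempty because (a + 1)² < 2, whence
the bound √2 - 1. -/
theorem exists_weight {a : ℝ} (ha : 0 < a) (h : a < √2 - 1) :
    ∃ s, 0 < s ∧ a * s < 1 ∧ 2 * a + a / s < 1 := by
  have h2 : (a + 1) ^ 2 < 2 := by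
    rw [← Real.lt_sqrt (by positivity)]
    linarith
  have h3 : 0 < 1 - 2 * a := by nlinarith
  obtain ⟨s, hs₁, hs₂⟩ := exists_between (show a / (1 - 2 * a) < 1 / a by
    rw [div_lt_div_iff₀ h3 ha]; nlinarith)
  have hs : 0 < s := (div_pos ha h3).trans hs₁
  rw [lt_div_iff₀ ha] at hs₂
  rw [div_lt_iff₀ h3] at hs₁
  refine ⟨s, hs, by linarith, ?_⟩
  have : a / s < 1 - 2 * a := by rw [div_lt_iff₀ hs]; linarith
  linarith

theorem IsReflectedOrbit.fejer_of_lipschitz {A : H → Set H} {B : H → H} {μ : ℝ≥0}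
    {γ : ℝ} (hγ : 0 < γ) (hμ : 0 < μ) (hγμ : γ < (√2 - 1) / μ) {w : ℕ → H}
    (hw : IsReflectedOrbit A B γ w) (hA : IsMonotoneOp A) (hB : IsMonotoneOp (toSetOp B))
    (hBL : LipschitzWith μ B) {z : H} (hz : z ∈ zer (A + toSetOp B)) :
    Tendsto (fun n => w (n + 1) - w n) atTop (𝓝 0) ∧
      ∃ r : ℝ, Tendsto (fun n => ‖w n - z‖ ^ 2) atTop (𝓝 r) := by
  obtain ⟨a, ha⟩ : ∃ a, a = γ * (μ : ℝ) := ⟨_, rfl⟩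
  have hμ' : 0 < (μ : ℝ) := hμ
  have ha0 : 0 < a := ha ▸ mul_pos hγ hμ'
  obtain ⟨s, hs, has, has'⟩ := exists_weight ha0 (by rwa [lt_div_iff₀ hμ', ← ha] at hγμ)
  have ha2 : 2 * a < 1 := by linarith [div_pos ha0 hs]
  have hlip : ∀ u v : H, γ * ‖B u - B v‖ ≤ a * ‖u - v‖ := fun u v => by
    rw [ha, mul_assoc]
    exact mul_le_mul_of_nonneg_left (hBL.norm_sub_le u v) hγ.le
  set b : ℕ → H := fun n => B ((2 : ℝ) • w (n + 1) - w n) - B z with hb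
  set d : ℕ → H := fun n => w (n + 1) - w n with hd
  set e : ℕ → H := fun n => d (n + 1) - d n with he
  have hbn : ∀ n, γ * ‖b n‖ ≤ a * (‖w (n + 2) - z‖ + ‖e n‖) := fun n => by
    refine (hlip _ _).trans (mul_le_mul_of_nonneg_left ?_ ha0.le)
    rw [show (2 : ℝ) • w (n + 1) - w n - z = (w (n + 2) - z) - e n by simp only [he, hd]; module]
    exact norm_sub_le _ _
  have hbb : ∀ n, γ * ‖b (n + 1) - b n‖ ≤ a * (‖d (n + 1)‖ + ‖e n‖) := fun n => by
    simp only [hb, sub_sub_sub_cancel_right]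
    refine (hlip _ _).trans (mul_le_mul_of_nonneg_left ?_ ha0.le)
    rw [show (2 : ℝ) • w (n + 1 + 1) - w (n + 1) - ((2 : ℝ) • w (n + 1) - w n) =
      d (n + 1) + e n by simp only [he, hd]; module]
    exact norm_add_le _ _
  -- Young with weight s on ‖d‖‖e‖ costs as‖d (n + 1)‖² and a‖e n‖², both prepaid by R.
  set R : ℕ → ℝ := fun n => 2 * γ * inner ℝ (b n) (d (n + 1)) + (1 + a * s) * ‖d (n + 1)‖ ^ 2 +
    a * ‖e n‖ ^ 2 with hR
  have hVlow : ∀ n, (1 - a) * ‖w (n + 2) - z‖ ^ 2 ≤ ‖w (n + 2) - z‖ ^ 2 + R n := fun n => by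
    have h₁ := (abs_le.1 (abs_real_inner_le_norm (b n) (d (n + 1)))).1
    have h₂ := mul_le_mul_of_nonneg_left h₁ hγ.le
    have h₃ := mul_le_mul_of_nonneg_right (hbn n) (norm_nonneg (d (n + 1)))
    have h₄ := mul_nonneg ha0.le (sq_nonneg (‖w (n + 2) - z‖ - ‖d (n + 1)‖))
    have h₅ := mul_nonneg ha0.le (sq_nonneg (‖e n‖ - ‖d (n + 1)‖))
    have h₆ : 0 ≤ (1 + a * s - 2 * a) * ‖d (n + 1)‖ ^ 2 :=
      mul_nonneg (by nlinarith) (sq_nonneg _)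
    simp only [hR]
    linarith
  obtain ⟨⟨r, hr⟩, hD⟩ := exists_tendsto_of_add_le (V := fun n => ‖w (n + 2) - z‖ ^ 2 + R n)
    (D := fun n => (1 - a * s) * ‖d (n + 2)‖ ^ 2)
    (fun n => (mul_nonneg (by linarith) (sq_nonneg _)).trans (hVlow n))
    (fun n => mul_nonneg (by linarith) (sq_nonneg _)) (fun n => by
      have h := hw.energy_step hγ hA hz n rfl rfl
      have hc : 0 ≤ 2 * γ * inner ℝ ((2 : ℝ) • w (n + 2) - w (n + 1) - z) (b (n + 1)) :=
        mul_nonneg (mul_pos two_pos hγ).le (hB _ _ _ _ rfl rfl)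
      have hbe : B ((2 : ℝ) • w (n + 2) - w (n + 1)) - B ((2 : ℝ) • w (n + 1) - w n) =
        b (n + 1) - b n := by simp only [hb]; abel
      rw [hbe] at h
      change _ + 2 * γ * inner ℝ (b (n + 1)) (d (n + 2)) + 2 * ‖d (n + 2)‖ ^ 2 +
        ‖e (n + 1)‖ ^ 2 + 2 * γ * inner ℝ _ (b (n + 1)) ≤
          _ + 2 * γ * inner ℝ (b n) (d (n + 1)) + ‖d (n + 1)‖ ^ 2 -
          2 * γ * inner ℝ _ (e (n + 1)) at h
      have h₁ := (abs_le.1 (abs_real_inner_le_norm (b (n + 1) - b n) (e (n + 1)))).1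
      have h₂ := mul_le_mul_of_nonneg_left h₁ hγ.le
      have h₃ := mul_le_mul_of_nonneg_right (hbb n) (norm_nonneg (e (n + 1)))
      have h₄ := mul_nonneg ha0.le (sq_nonneg (‖e n‖ - ‖e (n + 1)‖))
      have h₅ := mul_nonneg (div_pos ha0 hs).le (sq_nonneg (s * ‖d (n + 1)‖ - ‖e (n + 1)‖))
      have h₅' : a / s * (s * ‖d (n + 1)‖ - ‖e (n + 1)‖) ^ 2 = a * s * ‖d (n + 1)‖ ^ 2 -
          2 * a * ‖d (n + 1)‖ * ‖e (n + 1)‖ + a / s * ‖e (n + 1)‖ ^ 2 := by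
        field_simp
        ring
      have h₆ : 0 ≤ (1 - (2 * a + a / s)) * ‖e (n + 1)‖ ^ 2 :=
        mul_nonneg (by linarith) (sq_nonneg _)
      rw [h₅'] at h₅
      change ‖w (n + 3) - z‖ ^ 2 + (2 * γ * inner ℝ (b (n + 1)) (d (n + 2)) +
        (1 + a * s) * ‖d (n + 2)‖ ^ 2 + a * ‖e (n + 1)‖ ^ 2) + (1 - a * s) * ‖d (n + 2)‖ ^ 2 ≤
        ‖w (n + 2) - z‖ ^ 2 + (2 * γ * inner ℝ (b n) (d (n + 1)) +
        (1 + a * s) * ‖d (n + 1)‖ ^ 2 + a * ‖e n‖ ^ 2)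
      linarith)
  have hd0 : Tendsto d atTop (𝓝 0) := by
    rw [← tendsto_add_atTop_iff_nat 2]
    refine tendsto_zero_of_sq ?_
    simpa [(sub_pos.2 has).ne'] using hD.const_mul (1 - a * s)⁻¹
  have hd1 : Tendsto (fun n => d (n + 1)) atTop (𝓝 0) := hd0.comp (tendsto_add_atTop_nat 1)
  have he0 : Tendsto e atTop (𝓝 0) := by simpa using hd1.sub hd0
  refine ⟨hd0, r, (tendsto_add_atTop_iff_nat 2).1 ?_⟩
  -- The decrease does not control b here; it is only shown bounded, through `hVlow`, which suffices
  -- as d → 0.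
  obtain ⟨M, hM⟩ := hr.bddAbove_range
  obtain ⟨E, hE⟩ := he0.norm.bddAbove_range
  have hbM : ∀ n, ‖γ • b n‖ ≤ a * (√(M / (1 - a)) + E) := fun n => by
    rw [norm_smul, Real.norm_of_nonneg hγ.le]
    refine (hbn n).trans (mul_le_mul_of_nonneg_left (add_le_add ?_ (hE ⟨n, rfl⟩)) ha0.le)
    refine Real.le_sqrt_of_sq_le ?_
    rw [le_div_iff₀' (by linarith)]
    exact (hVlow n).trans (hM ⟨n, rfl⟩)
  have hR0 : Tendsto R atTop (𝓝 0) := by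
    have h := (((tendsto_inner_of_bdd_of_zero hbM hd1).const_mul 2).add
      ((hd1.norm.pow 2).const_mul (1 + a * s))).add ((he0.norm.pow 2).const_mul a)
    simp only [norm_zero, ne_eq, OfNat.ofNat_ne_zero, not_false_eq_true, zero_pow, mul_zero,
      add_zero] at h
    refine h.congr fun n => ?_
    rw [inner_smul_left, RCLike.conj_to_real, ← mul_assoc]
  simpa using hr.sub hR0

end MonotoneInclusion

theorem theorem1 {H : Type*} [NormedAddCommGroup H] [InnerProductSpace ℝ H] [CompleteSpace H]
    (A : H → Set H) (B : H → H) (μ : ℝ≥0) (hμ : 0 < μ)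
    (hA : MonotoneInclusion.IsMaximallyMonotone A)
    (hB : MonotoneInclusion.IsMonotoneOp (MonotoneInclusion.toSetOp B))
    (hBL : LipschitzWith μ B)
    (hzer : (MonotoneInclusion.zer (A + MonotoneInclusion.toSetOp B)).Nonempty)
    (γ : ℝ) (xneg : H) (x y : ℕ → H)
    (hx : MonotoneInclusion.IsReflectedForwardBackward A B γ xneg x y) :
    (∀ β : ℝ, 0 < β → ∀ ε ∈ Ioo (0 : ℝ) 1, MonotoneInclusion.IsCocoercive β B →
      γ ∈ Ioc (0 : ℝ) (β * (1 - ε) / 2) →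
      ∃ xbar ∈ MonotoneInclusion.zer (A + MonotoneInclusion.toSetOp B),
        MonotoneInclusion.WeaklyConvergesTo x xbar) ∧
    (γ ∈ Ioo (0 : ℝ) ((√2 - 1) / μ) →
      ∃ xbar ∈ MonotoneInclusion.zer (A + MonotoneInclusion.toSetOp B),
        MonotoneInclusion.WeaklyConvergesTo x xbar) := by
  have reduce : 0 < γ → (∀ w, MonotoneInclusion.IsReflectedOrbit A B γ w →
      ∀ z ∈ MonotoneInclusion.zer (A + MonotoneInclusion.toSetOp B),
        Tendsto (fun n => w (n + 1) - w n) atTop (𝓝 0) ∧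
          ∃ r : ℝ, Tendsto (fun n => ‖w n - z‖ ^ 2) atTop (𝓝 r)) →
      ∃ xbar ∈ MonotoneInclusion.zer (A + MonotoneInclusion.toSetOp B),
        MonotoneInclusion.WeaklyConvergesTo x xbar := by
    intro hγ h
    have hw := hx.isReflectedOrbit hγ.ne'
    obtain ⟨z, hz⟩ := hzer
    obtain ⟨l, hl, hlim⟩ := hw.exists_weak_limit hγ.ne' hA hB hBL ⟨z, hz⟩ (h _ hw z hz).1
      fun z hz => (h _ hw z hz).2
    -- Dropping the term of index 0, `xneg`, recovers x.
    exact ⟨l, hl, hlim.comp (tendsto_add_atTop_nat 1)⟩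
  refine ⟨fun β hβ ε hε hBc hγ => reduce hγ.1 fun w hw z hz => ?_,
    fun hγ => reduce hγ.1 fun w hw z hz => ?_⟩
  · exact hw.fejer_of_cocoercive hγ.1 (by nlinarith [hγ.2, mul_pos hβ hε.1]) hA.1 hBc hz
  · exact hw.fejer_of_lipschitz hγ.1 hμ hγ.2 hA.1 hB hBL hz
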